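/- Let $f:\mathbb{R}^n\to\mathbb{R}$ and $g:\mathbb{R}^n\to\mathbb{R}^m$ be twice continuously differentiable, let $K\subseteq\mathbb{R}^m$ be closed, and let $C:=g^{-1}(K)$. **Notation.** Here $t_k\downarrow 0$ means $t_k>0$ and $t_k\to0$. For a closed set $S\subseteq\mathbb{R}^p$, a point $\bar y\in S$ and a direction $h\in\mathbb{R}^p$, put - $T_S(\bar y):=\{w : \exists\, t_k\downarrow 0,\ w_k\to w \text{ with } \bar y+t_kw_k\in S \text{ for all } k\}$; - $T''_S(\bar y;h):=\{w : \exists\, t_k\downarrow 0,\ r_k\downarrow0,\ w_k\to w \text{ with } t_k/r_k\to0 \text{ and } \bar y+t_kh+\tfrac12t_kr_kw_k\in S \text{ for all } k\}$; - $\hat N_S(y):=\{v : \limsup_{z\to y,\ z\in S\setminus\{y\}}\langle v,z-y\rangle/\|z-y\|\le 0\}$ for $y\in S$, and $\hat N_S(y):=\emptyset$ for $y\notin S$; - $N_S(\bar y;h):=\{v : \exists\, t_k\downarrow0,\ h_k\to h,\ v_k\to v \text{ with } v_k\in\hat N_S(\bar y+t_kh_k) \text{ for all } k\}$; - $N^c_S(\bar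 y;h):=\operatorname{cl}\operatorname{co}N_S(\bar y;h)$, the directional Clarke normal cone. Let $\sigma_S(\lambda):=\sup_{u\in S}\langle\lambda,u\rangle$ be the support function of $S$, let $L(x,\lambda):=f(x)+\langle\lambda,g(x)\rangle$, and let $$\Lambda^c(\bar x;d):=\{\lambda\in\mathbb{R}^m : \lambda\in N^c_K(g(\bar x);\nabla g(\bar x)d),\ \nabla_xL(\bar x,\lambda)=0\}$$ be the set of directional Clarke multipliers. **Statement.** Let $\bar x\in C$ and $d\in T_C(\bar x)$. Suppose that $\bar x$ is a local minimizer of $f$ over $C$ in direction $d$, that is, there are $\rho,\delta>0$ such that $f(x)\ge f(\bar x)$ for all $x\in C$ for which $w:=x-\bar x$ satisfies $\|w\|\le\delta$ and $\big\|\|d\|w-\|w\|d\big\|\le\rho\|w\|\|d\|$. Suppose that $\nabla f(\bar x)d=0$, and that the directional Robinson constraint qualification holds: $$\nabla g(\bar x)^T\lambda=0,\ \lambda\in N^c_K(g(\bar x);\nabla g(\bar x)d)\ \Longrightarrow\ \lambda=0 .$$ Then the following three statements are equivalent: (i) $\nabla f(\bar x)v\ge0$ for all $v\in T''_C(\bar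 x;d)$; (ii) for every $u\in T''_K(g(\bar x);\nabla g(\bar x)d)$ there exists $\lambda_u\in\Lambda^c(\bar x;d)$ with $\langle\lambda_u,u\rangle\le0$; (iii) for every nonempty convex set $K(d)\subseteq T''_K(g(\bar x);\nabla g(\bar x)d)$ there exists $\lambda\in\Lambda^c(\bar x;d)$ with $\sigma_{K(d)}(\lambda)\le0$. -/

import Mathlib

open Filter Topology

noncomputable section

namespace DirVar

section Cones

variable {E : Type*} [NormedAddCommGroup E] [InnerProductSpace ℝ E]

/-- `t k ↓ 0`: a sequence of positive reals converging to `0`. -/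
def DownToZero (t : ℕ → ℝ) : Prop :=
  (∀ k, 0 < t k) ∧ Tendsto t atTop (𝓝 0)

/-- The (Bouligand) tangent cone `T_S(x)` to `S` at a point `x ∈ S`. -/
def tangentCone (S : Set E) (x : E) : Set E :=
  {d | ∃ (t : ℕ → ℝ) (d' : ℕ → E), DownToZero t ∧ Tendsto d' atTop (𝓝 d) ∧
    ∀ k, x + t k • d' k ∈ S}

/-- The asymptotic second-order tangent cone `T''_S(x; d)`. -/
def asymptoticTangentCone (S : Set E) (x d : E) : Set E :=
  {w | ∃ (t r : ℕ → ℝ) (w' : ℕ → E), DownToZero t ∧ DownToZero r ∧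
    Tendsto w' atTop (𝓝 w) ∧ Tendsto (fun k => t k / r k) atTop (𝓝 0) ∧
    ∀ k, x + t k • d + ((1 / 2 : ℝ) * t k * r k) • w' k ∈ S}

/-- The Fréchet normal cone to `S` at `x`: those `v` for which the upper limit of
`⟨v, y - x⟩ / ‖y - x‖`, as `y → x` in `S`, is at most `0`. It is empty when `x ∉ S`. -/
def frechetNormalCone (S : Set E) (x : E) : Set E :=
  {v | x ∈ S ∧ ∀ ε : ℝ, 0 < ε → ∀ᶠ y in 𝓝[S] x, inner ℝ v (y - x) ≤ ε * ‖y - x‖}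

/-- The limiting normal cone `N_S(x; d)` to `S` at `x` in direction `d`: the outer limit of the
Fréchet normal cones at `x + t d'` as `t ↓ 0` and `d' → d`. -/
def dirLimitingNormalCone (S : Set E) (x d : E) : Set E :=
  {v | ∃ (t : ℕ → ℝ) (d' v' : ℕ → E), DownToZero t ∧ Tendsto d' atTop (𝓝 d) ∧
    Tendsto v' atTop (𝓝 v) ∧ ∀ k, v' k ∈ frechetNormalCone S (x + t k • d' k)}

/-- The directional Clarke normal cone `N^c_S(x; d) = cl co N_S(x; d)`. -/
def dirClarkeNormalCone (S : Set E) (x d : E) : Set E :=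
  closure (convexHull ℝ (dirLimitingNormalCone S x d))

/-- The directional neighbourhood `V_{ρ,δ}(d)` of the origin. -/
def dirNhd (ρ δ : ℝ) (d : E) : Set E :=
  {w | ‖w‖ ≤ δ ∧ ‖‖d‖ • w - ‖w‖ • d‖ ≤ ρ * ‖w‖ * ‖d‖}

/-- `x` is a local optimal solution of `min f` subject to membership in `C`, in direction `d`. -/
def IsDirLocalMin (f : E → ℝ) (C : Set E) (x d : E) : Prop :=
  x ∈ C ∧ ∃ ρ δ : ℝ, 0 < ρ ∧ 0 < δ ∧ ∀ y ∈ C, y - x ∈ dirNhd ρ δ d → f x ≤ f y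

/-- The support function `σ_S(x) = sup_{u ∈ S} ⟨x, u⟩`, with extended real values. -/
def supportFun (S : Set E) (x : E) : EReal :=
  ⨆ u ∈ S, ((inner ℝ x u : ℝ) : EReal)

end Cones

section Problem

variable {n m : ℕ}

/-- The Lagrangian `L(x, lam) = f(x) + ⟨lam, g(x)⟩`. -/
def lagrangian (f : EuclideanSpace ℝ (Fin n) → ℝ)
    (g : EuclideanSpace ℝ (Fin n) → EuclideanSpace ℝ (Fin m))
    (x : EuclideanSpace ℝ (Fin n)) (lam : EuclideanSpace ℝ (Fin m)) : ℝ :=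
  f x + inner ℝ lam (g x)

/-- The directional Clarke multiplier set `Λ^c(x; d)`. -/
def dirClarkeMultipliers (f : EuclideanSpace ℝ (Fin n) → ℝ)
    (g : EuclideanSpace ℝ (Fin n) → EuclideanSpace ℝ (Fin m))
    (K : Set (EuclideanSpace ℝ (Fin m))) (x d : EuclideanSpace ℝ (Fin n)) :
    Set (EuclideanSpace ℝ (Fin m)) :=
  {lam | lam ∈ dirClarkeNormalCone K (g x) (fderiv ℝ g x d) ∧
    gradient (fun y => lagrangian f g y lam) x = 0}

/-- The directional Robinson constraint qualification for `g(x) ∈ K` at `x` in direction `d`. -/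
def DirRobinsonCQ (g : EuclideanSpace ℝ (Fin n) → EuclideanSpace ℝ (Fin m))
    (K : Set (EuclideanSpace ℝ (Fin m))) (x d : EuclideanSpace ℝ (Fin n)) : Prop :=
  ∀ lam : EuclideanSpace ℝ (Fin m), ContinuousLinearMap.adjoint (fderiv ℝ g x) lam = 0 →
    lam ∈ dirClarkeNormalCone K (g x) (fderiv ℝ g x d) → lam = 0

end Problem

end DirVar

end

/-! Write `A = fderiv ℝ g x`, `N` for the limiting normal cone of `K` at `g x` in direction `A d`,
and `P` for its polar.

(ii) ⇒ (i): `A` maps second-order tangents of `g ⁻¹' K` to those of `K`, since the quadratic error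
of `g` is `O(t²) = o(t r)`; stationarity of the Lagrangian then transfers the sign. (iii) ⇒ (ii) is
the case of a singleton.

(i) ⇒ (iii): if `A v = u + p` with `u` a second-order tangent of `K` and `p ∈ P`, then `v` is a
second-order tangent of `g ⁻¹' K` (`mem_asymptoticTangentCone_preimage`). Indeed `K` can be followed
along `p`, uniformly near the direction `A d`, with error `o(ε)` (`infDist_add_smul_le_of_polar`),
and directional metric subregularity (`exists_dist_le_infDist_of_directional_criterion`) moves the
resulting almost feasible points into `g ⁻¹' K`. So (i) makes `fderiv ℝ f x` nonnegative wherever `A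
v ∈ Kd + P`. Separation gives a multiplier (`exists_multiplier_of_forall_nonneg`): the bipolar
theorem places it in the closed convex hull of `N`, and the qualification excludes the abnormal
case. -/

namespace DirVar

/-! ### Directional normals and regular tangent directions -/

section Normals

variable {E : Type*} [NormedAddCommGroup E] [InnerProductSpace ℝ E]

lemma smul_mem_frechetNormalCone {S : Set E} {x v : E} (hv : v ∈ frechetNormalCone S x) {c : ℝ}
    (hc : 0 ≤ c) : c • v ∈ frechetNormalCone S x := by
  refine ⟨hv.1, fun ε hε => ?_⟩
  filter_upwards [hv.2 (ε / (c + 1)) (by positivity)] with y hy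
  rw [real_inner_smul_left]
  calc c * inner ℝ v (y - x) ≤ c * (ε / (c + 1) * ‖y - x‖) := by gcongr
    _ = c / (c + 1) * (ε * ‖y - x‖) := by ring
    _ ≤ 1 * (ε * ‖y - x‖) := by
        gcongr
        rw [div_le_one (by positivity)]
        linarith
    _ = ε * ‖y - x‖ := one_mul _

lemma zero_mem_frechetNormalCone {S : Set E} {x : E} (hx : x ∈ S) :
    (0 : E) ∈ frechetNormalCone S x :=
  ⟨hx, fun ε hε => Eventually.of_forall fun y => by rw [inner_zero_left]; positivity⟩

lemma smul_mem_dirLimitingNormalCone {S : Set E} {x d v : E}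
    (hv : v ∈ dirLimitingNormalCone S x d) {c : ℝ} (hc : 0 ≤ c) :
    c • v ∈ dirLimitingNormalCone S x d := by
  obtain ⟨t, d', v', ht, hd', hv', h⟩ := hv
  exact ⟨t, d', fun k => c • v' k, ht, hd', hv'.const_smul c,
    fun k => smul_mem_frechetNormalCone (h k) hc⟩

/-- Without tangency of `d` the cone is empty; the duality argument needs the origin in it. -/
lemma zero_mem_dirLimitingNormalCone {S : Set E} {x d : E} (hd : d ∈ tangentCone S x) :
    (0 : E) ∈ dirLimitingNormalCone S x d := by
  obtain ⟨t, d', ht, hd', h⟩ := hd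
  exact ⟨t, d', fun _ => 0, ht, hd', tendsto_const_nhds,
    fun k => zero_mem_frechetNormalCone (h k)⟩

lemma dirLimitingNormalCone_subset_dirClarkeNormalCone {S : Set E} {x d : E} :
    dirLimitingNormalCone S x d ⊆ dirClarkeNormalCone S x d :=
  (subset_convexHull ℝ _).trans subset_closure

/-- The residual of a nearest-point projection is a Fréchet normal. -/
lemma sub_mem_frechetNormalCone_of_infDist_eq {S : Set E} {z w : E} (hw : w ∈ S)
    (h : Metric.infDist z S = ‖z - w‖) : z - w ∈ frechetNormalCone S w := by
  refine ⟨hw, fun ε hε => ?_⟩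
  filter_upwards [self_mem_nhdsWithin, mem_nhdsWithin_of_mem_nhds (Metric.ball_mem_nhds w hε)]
    with y hy hyε
  have h1 : ‖z - w‖ ≤ ‖z - y‖ := by
    rw [← h, ← dist_eq_norm]
    exact Metric.infDist_le_dist_of_mem hy
  have h2 : ‖z - y‖ ^ 2 = ‖z - w‖ ^ 2 - 2 * inner ℝ (z - w) (y - w) + ‖y - w‖ ^ 2 := by
    rw [← norm_sub_sq_real, sub_sub_sub_cancel_right]
  have h3 : ‖z - w‖ ^ 2 ≤ ‖z - y‖ ^ 2 := by gcongr
  have h4 : ‖y - w‖ < ε := by rwa [Metric.mem_ball, dist_eq_norm] at hyε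
  nlinarith [norm_nonneg (y - w)]

/-- A continuous function that is positive on the unit vectors of the directional limiting normal
cone is bounded below on the unit Fréchet normals at nearby points in that direction. -/
lemma exists_le_of_unit_frechetNormal [FiniteDimensional ℝ E] {S : Set E} {x d : E} {F : E → ℝ}
    (hF : Continuous F) (h : ∀ v ∈ dirLimitingNormalCone S x d, ‖v‖ = 1 → 0 < F v) :
    ∃ ρ : ℝ, 0 < ρ ∧ ∀ t, 0 < t → t < ρ → ∀ w, ‖w - (x + t • d)‖ ≤ ρ * t →
      ∀ v ∈ frechetNormalCone S w, ‖v‖ = 1 → ρ ≤ F v := by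
  -- Compactness: counterexamples for `ρ = 1 / (j + 1)` have unit normals clustering at some `v₀`.
  -- Their base points are `x + t d'` with `d' → d`, so `v₀` is a directional limiting normal with
  -- `F v₀ ≤ 0`.
  by_contra! hcon
  choose t ht0 ht w hw v hv hv1 hFv using
    fun j : ℕ => hcon (1 / ((j : ℝ) + 1)) (by positivity)
  obtain ⟨v₀, hv₀, φ, hφ, hlim⟩ := (isCompact_sphere (0 : E) 1).tendsto_subseq
    (x := v) (fun j => by simpa using hv1 j)
  have hinv := tendsto_one_div_add_atTop_nhds_zero_nat (𝕜 := ℝ)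
  have ht' : Tendsto t atTop (𝓝 0) :=
    squeeze_zero (fun j => (ht0 j).le) (fun j => (ht j).le) hinv
  have hd' : Tendsto (fun j => (t j)⁻¹ • (w j - x)) atTop (𝓝 d) := by
    rw [tendsto_iff_norm_sub_tendsto_zero]
    refine squeeze_zero (fun j => norm_nonneg _) (fun j => ?_) hinv
    have : (t j)⁻¹ • (w j - x) - d = (t j)⁻¹ • (w j - (x + t j • d)) := by
      rw [← sub_sub, smul_sub _ _ (t j • d), inv_smul_smul₀ (ht0 j).ne']
    rw [this, norm_smul, norm_inv, Real.norm_of_nonneg (ht0 j).le, inv_mul_le_iff₀ (ht0 j),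
      mul_comm]
    exact hw j
  have hmem : v₀ ∈ dirLimitingNormalCone S x d := by
    refine ⟨t ∘ φ, fun j => (t (φ j))⁻¹ • (w (φ j) - x), v ∘ φ,
      ⟨fun j => ht0 _, ht'.comp hφ.tendsto_atTop⟩, hd'.comp hφ.tendsto_atTop, hlim, fun j => ?_⟩
    have : x + (t ∘ φ) j • (t (φ j))⁻¹ • (w (φ j) - x) = w (φ j) := by
      rw [Function.comp_apply, smul_inv_smul₀ (ht0 _).ne']
      abel
    rw [this]
    exact hv _
  have hle : F v₀ ≤ 0 := le_of_tendsto_of_tendsto ((hF.tendsto v₀).comp hlim)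
    (hinv.comp hφ.tendsto_atTop) (Eventually.of_forall fun j => (hFv (φ j)).le)
  exact (h v₀ hmem (by simpa using hv₀)).not_ge hle

/-- The derivative of `‖·‖` along a curve that does not vanish. -/
lemma hasDerivAt_norm_of_ne_zero {γ : ℝ → E} {γ' : E} {s : ℝ} (hγ : HasDerivAt γ γ' s)
    (h0 : γ s ≠ 0) :
    HasDerivAt (fun τ => ‖γ τ‖) (inner ℝ (‖γ s‖⁻¹ • γ s) γ') s := by
  have h := hγ.norm_sq.sqrt (by positivity)
  simp only [Real.sqrt_sq (norm_nonneg _)] at h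
  convert h using 1
  rw [real_inner_smul_left]
  field_simp

variable [FiniteDimensional ℝ E]

/-- Vectors polar to the directional limiting normal cone are regular tangent directions. -/
lemma infDist_add_smul_le_of_polar {S : Set E} (hS : IsClosed S) {x d p : E}
    (hp : ∀ v ∈ dirLimitingNormalCone S x d, inner ℝ v p ≤ 0) {η : ℝ} (hη : 0 < η) :
    ∃ ρ : ℝ, 0 < ρ ∧ ∀ t, 0 < t → t < ρ → ∀ y ∈ S, ‖y - (x + t • d)‖ ≤ ρ * t →
      ∀ ε, 0 ≤ ε → ε ≤ ρ * t → Metric.infDist (y + ε • p) S ≤ η * ε := by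
  obtain ⟨ρ, hρ, H⟩ := exists_le_of_unit_frechetNormal (S := S) (x := x) (d := d)
    (F := fun v => η - inner ℝ v p) (by fun_prop)
    (fun v hv _ => by linarith [hp v hv])
  -- For `s ≤ ε`, a projection of `y + s • p` lies within `2 * s * ‖p‖` of `y`; this radius keeps it
  -- in the region where `H` applies.
  refine ⟨ρ / (2 * ‖p‖ + 2), by positivity, fun t ht0 ht y hy hyt ε hε0 hεt => ?_⟩
  have hden : 0 < 2 * ‖p‖ + 2 := by positivity
  have hρ' : ρ / (2 * ‖p‖ + 2) ≤ ρ :=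
    div_le_self hρ.le (by linarith [norm_nonneg p])
  have hρm : ρ / (2 * ‖p‖ + 2) * (2 * ‖p‖ + 2) = ρ := div_mul_cancel₀ _ hden.ne'
  set ρ₁ := ρ / (2 * ‖p‖ + 2) with hρ₁
  set φ : ℝ → ℝ := fun s => Metric.infDist (y + s • p) S with hφ
  have hφc : Continuous φ := (Metric.continuous_infDist_pt S).comp (by fun_prop)
  -- With `w` a projection of `y + s • p`, the function `τ ↦ ‖y + τ • p - w‖` majorizes `φ` and
  -- touches it at `s`; its derivative there is `⟨v, p⟩ ≤ η - ρ` for a unit normal `v`.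
  have hslope : ∀ s ∈ Set.Ico 0 ε, 0 < φ s → ∀ r, η - ρ < r →
      ∃ᶠ z in 𝓝[>] s, slope φ s z < r := by
    intro s hs hpos r hr
    obtain ⟨w, hwS, hw⟩ := hS.exists_infDist_eq_dist ⟨y, hy⟩ (y + s • p)
    rw [dist_eq_norm] at hw
    have hnorm : 0 < ‖y + s • p - w‖ := hw ▸ hpos
    have hne : y + s • p - w ≠ 0 := norm_pos_iff.1 hnorm
    have hds : φ s ≤ s * ‖p‖ := by
      refine (Metric.infDist_le_dist_of_mem hy).trans ?_
      rw [dist_eq_norm, add_sub_cancel_left, norm_smul, Real.norm_of_nonneg hs.1]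
    have hwy : ‖w - (x + t • d)‖ ≤ ρ * t := by
      have e : w - (x + t • d) = (y - (x + t • d)) + s • p - (y + s • p - w) := by abel
      have h1 : ‖w - (x + t • d)‖ ≤ ‖y - (x + t • d)‖ + ‖s • p‖ + ‖y + s • p - w‖ := by
        rw [e]
        exact (norm_sub_le _ _).trans (by gcongr; exact norm_add_le _ _)
      rw [norm_smul, Real.norm_of_nonneg hs.1, ← hw] at h1
      have h2 : s * ‖p‖ ≤ ρ₁ * t * ‖p‖ := by gcongr; exact hs.2.le.trans hεt
      change φ s ≤ _ at hds
      change _ ≤ _ + φ s at h1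
      calc _ ≤ ρ₁ * t + 2 * (ρ₁ * t * ‖p‖) := by linarith
        _ ≤ ρ₁ * (2 * ‖p‖ + 2) * t := by nlinarith [mul_pos (show 0 < ρ₁ by positivity) ht0]
        _ = ρ * t := by rw [hρm]
    have hv := H t ht0 (ht.trans_le hρ') w hwy _
      (smul_mem_frechetNormalCone (sub_mem_frechetNormalCone_of_infDist_eq hwS hw)
        (inv_nonneg.2 hnorm.le)) (norm_smul_inv_norm (𝕜 := ℝ) hne)
    have hder := (hasDerivAt_norm_of_ne_zero (γ := fun s => y + s • p - w) (γ' := p) (s := s)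
      (by simpa using (((hasDerivAt_id s).smul_const p).const_add y).sub_const w) hne)
    have htend := (hasDerivWithinAt_iff_tendsto_slope' Set.self_notMem_Ioi).1
      (hder.hasDerivWithinAt (s := Set.Ioi s))
    have hev := htend.eventually_lt_const (show _ < r by linarith)
    refine (hev.and self_mem_nhdsWithin).frequently.mono fun z hz => hz.1.trans_le' ?_
    have hz' : 0 < z - s := sub_pos.2 hz.2
    simp only [slope_def_field]
    gcongr
    · exact (Metric.infDist_le_dist_of_mem hwS).trans_eq (dist_eq_norm _ _)
    · exact hw.ge
  -- Comparison with the line `δ + η * s`: at a contact point `δ > 0` forces `φ > 0`, where the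
  -- slope bound is strictly below `η`. Where `φ = 0`, the Lipschitz constant `‖p‖` suffices.
  have key : ∀ δ : ℝ, 0 < δ → φ ε ≤ δ + η * ε := by
    intro δ hδ
    refine image_le_of_liminf_slope_right_lt_deriv_boundary' (f := φ) (a := 0) (b := ε)
      (f' := fun s => if 0 < φ s then η - ρ else ‖p‖) (B := fun s => δ + η * s) (B' := fun _ => η)
      hφc.continuousOn ?_ ?_ (by fun_prop) ?_ ?_ (Set.right_mem_Icc.2 hε0)
    · intro s hs r hr
      split_ifs at hr with hpos
      · exact hslope s hs hpos r hr
      · have hgt : ∀ᶠ z in 𝓝[>] s, s < z := eventually_mem_nhdsWithin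
        refine (hgt.mono fun z hz => ?_).frequently
        refine hr.trans_le' ?_
        rw [slope_def_field, div_le_iff₀ (sub_pos.2 hz), sub_le_iff_le_add']
        refine (Metric.infDist_le_infDist_add_dist (y := y + s • p)).trans_eq ?_
        rw [dist_eq_norm, add_sub_add_left_eq_sub, ← sub_smul, norm_smul,
          Real.norm_of_nonneg (sub_pos.2 hz).le, mul_comm]
    · simp only [hφ, zero_smul, add_zero, mul_zero, Metric.infDist_zero_of_mem hy]
      exact hδ.le
    · intro s _
      simpa using (((hasDerivAt_id s).const_mul η).const_add δ).hasDerivWithinAt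
    · intro s hs hsB
      have hpos : 0 < φ s := by
        rw [hsB]
        exact add_pos_of_pos_of_nonneg hδ (mul_nonneg hη.le hs.1)
      simp only [if_pos hpos]
      linarith
  exact le_of_forall_pos_le_add fun δ hδ => by linarith [key δ hδ]

end Normals

/-! ### Directional metric subregularity -/

section Regularity

variable {E F : Type*} [NormedAddCommGroup E] [InnerProductSpace ℝ E] [FiniteDimensional ℝ E]
  [NormedAddCommGroup F] [InnerProductSpace ℝ F] [FiniteDimensional ℝ F]

/-- First-order optimality for the penalized distance to a constraint set. -/
lemma norm_adjoint_le_of_penalized_min {g : E → F} {K : Set F} {z z₀ : E} {a : ℝ}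
    (hg : DifferentiableAt ℝ g z) (ha : 0 ≤ a)
    (hz : ∀ z', Metric.infDist (g z) K + a * ‖z - z₀‖ ≤ Metric.infDist (g z') K + a * ‖z' - z₀‖)
    {w : F} (hwK : w ∈ K) (hw : Metric.infDist (g z) K = ‖g z - w‖) (hne' : g z - w ≠ 0) :
    ‖ContinuousLinearMap.adjoint (fderiv ℝ g z) (‖g z - w‖⁻¹ • (g z - w))‖ ≤ a := by
  set v := ‖g z - w‖⁻¹ • (g z - w) with hv
  set e := ContinuousLinearMap.adjoint (fderiv ℝ g z) v with he
  -- Along `-e` the distance to `w` has slope `-‖e‖ ^ 2`, while the penalty grows at rate at most `a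
  -- * ‖e‖`; minimality compares the two.
  have hγ : HasDerivAt (fun τ : ℝ => g (z + τ • -e) - w) (fderiv ℝ g z (-e)) 0 := by
    have hline : HasDerivAt (fun τ : ℝ => z + τ • -e) (-e) 0 := by
      simpa using ((hasDerivAt_id (0 : ℝ)).smul_const (-e)).const_add z
    have hg' : HasFDerivAt g (fderiv ℝ g z) (z + (0 : ℝ) • -e) := by
      simpa using hg.hasFDerivAt
    exact (hg'.comp_hasDerivAt (0 : ℝ) hline).sub_const w
  have hnd := hasDerivAt_norm_of_ne_zero hγ (by simpa using hne')
  simp only [zero_smul, add_zero, ← hv] at hnd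
  have hval : inner ℝ v (fderiv ℝ g z (-e)) = -‖e‖ ^ 2 := by
    rw [map_neg, inner_neg_right, ← ContinuousLinearMap.adjoint_inner_left, ← he,
      real_inner_self_eq_norm_sq]
  rw [hval] at hnd
  have htend := (hasDerivWithinAt_iff_tendsto_slope' Set.self_notMem_Ioi).1
    (hnd.hasDerivWithinAt (s := Set.Ioi 0))
  have hge : -(a * ‖e‖) ≤ -‖e‖ ^ 2 := by
    refine ge_of_tendsto htend ?_
    filter_upwards [self_mem_nhdsWithin] with τ hτ
    have hτ0 : 0 < τ := hτ
    rw [slope_def_field, sub_zero, le_div_iff₀ hτ0]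
    simp only [zero_smul, add_zero]
    have h1 := hz (z + τ • -e)
    have h2 : Metric.infDist (g (z + τ • -e)) K ≤ ‖g (z + τ • -e) - w‖ :=
      (Metric.infDist_le_dist_of_mem hwK).trans_eq (dist_eq_norm _ _)
    have h3 : ‖z + τ • -e - z₀‖ ≤ ‖z - z₀‖ + τ * ‖e‖ := by
      calc ‖z + τ • -e - z₀‖ = ‖(z - z₀) + τ • -e‖ := by congr 1; abel
        _ ≤ _ := by
          refine (norm_add_le _ _).trans_eq ?_
          rw [norm_smul, norm_neg, Real.norm_of_nonneg hτ0.le]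
    have h4 : a * ‖z + τ • -e - z₀‖ ≤ a * (‖z - z₀‖ + τ * ‖e‖) := by gcongr
    linarith
  rcases (norm_nonneg e).eq_or_lt' with h0 | h0
  · exact h0.trans_le ha
  · exact le_of_mul_le_mul_right (by linarith) h0

/-- Directional metric subregularity of the constraint `g x ∈ K`, from a directional
Mordukhovich-type criterion. -/
lemma exists_dist_le_infDist_of_directional_criterion {g : E → F} {K : Set F}
    (hg : ContDiff ℝ 1 g) (hK : IsClosed K) (hne : K.Nonempty) {x d : E}
    (hCQ : ∀ v ∈ dirLimitingNormalCone K (g x) (fderiv ℝ g x d),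
      ContinuousLinearMap.adjoint (fderiv ℝ g x) v = 0 → v = 0) :
    ∃ κ ρ : ℝ, 0 < κ ∧ 0 < ρ ∧ ∀ t, 0 < t → t < ρ → ∀ z, ‖z - (x + t • d)‖ ≤ ρ * t →
      Metric.infDist (g z) K ≤ ρ * t →
      ∃ z' ∈ g ⁻¹' K, ‖z' - z‖ ≤ κ * Metric.infDist (g z) K := by
  set A := fderiv ℝ g x with hA
  obtain ⟨c, hc, H⟩ := exists_le_of_unit_frechetNormal (S := K) (x := g x) (d := A d)
    (F := fun v => ‖ContinuousLinearMap.adjoint A v‖) (by fun_prop)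
    (fun v hv hv1 => norm_pos_iff.2 fun h0 => by simp [hCQ v hv h0] at hv1)
  -- near `x`, `g` is close to its linearization
  have hdiff : Differentiable ℝ g := hg.differentiable one_ne_zero
  obtain ⟨r, hr, hr'⟩ : ∃ r : ℝ, 0 < r ∧ ∀ z, ‖z - x‖ < r → ‖fderiv ℝ g z - A‖ < c / 4 := by
    have := Metric.continuous_iff.1 (hg.continuous_fderiv one_ne_zero) x (c / 4) (by positivity)
    simpa [dist_eq_norm] using this
  obtain ⟨r₁, hr₁, hlin⟩ : ∃ r₁ : ℝ, 0 < r₁ ∧ ∀ z, ‖z - x‖ < r₁ →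
      ‖g z - g x - A (z - x)‖ ≤ c / (4 * (‖d‖ + 1)) * ‖z - x‖ := by
    have := (hdiff x).hasFDerivAt.isLittleO.def (show 0 < c / (4 * (‖d‖ + 1)) by positivity)
    obtain ⟨r₁, h1, h2⟩ := Metric.eventually_nhds_iff.1 this
    exact ⟨r₁, h1, fun z hz => h2 (by rwa [dist_eq_norm])⟩
  have hAadj : ∀ z v, ‖v‖ = 1 → ‖z - x‖ < r →
      ‖ContinuousLinearMap.adjoint A v‖ - c / 4 ≤
        ‖ContinuousLinearMap.adjoint (fderiv ℝ g z) v‖ := by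
    intro z v hv hz
    have h1 : ‖ContinuousLinearMap.adjoint (fderiv ℝ g z - A) v‖ ≤ c / 4 := by
      refine (ContinuousLinearMap.le_opNorm _ _).trans ?_
      rw [hv, mul_one, LinearIsometryEquiv.norm_map]
      exact (hr' z hz).le
    rw [map_sub, sub_apply] at h1
    have h2 := norm_sub_norm_le (ContinuousLinearMap.adjoint A v)
      (ContinuousLinearMap.adjoint (fderiv ℝ g z) v)
    rw [norm_sub_rev] at h2
    linarith
  set κ := 2 / c with hκ
  have hκ0 : 0 < κ := by positivity
  -- In order, the bounds give `‖z - x‖ ≤ (1 + ‖d‖) * t`, place the projection of `g z` within `c *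
  -- t` of `g x + t • A d`, ensure `t < c`, and keep `z` in the balls of radii `r` and `r₁`.
  obtain ⟨ρ, hρ, hρ1, hρ2, hρ3, hρ4, hρ5⟩ : ∃ ρ : ℝ, 0 < ρ ∧ ρ ≤ 1 / (κ + 1) ∧
      ρ ≤ c / 2 / (1 + ‖A‖ * (κ + 1)) ∧ ρ ≤ c ∧ ρ ≤ r / (1 + ‖d‖) ∧ ρ ≤ r₁ / (1 + ‖d‖) :=
    ⟨min (1 / (κ + 1)) (min (c / 2 / (1 + ‖A‖ * (κ + 1))) (min c (min (r / (1 + ‖d‖))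
      (r₁ / (1 + ‖d‖))))), by positivity, by simp, by simp, by simp, by simp, by simp⟩
  have hd1 : 0 < 1 + ‖d‖ := by positivity
  rw [le_div_iff₀ (by positivity)] at hρ1 hρ2 hρ4 hρ5
  refine ⟨κ, ρ, hκ0, hρ, fun t ht0 ht z₀ hz₀ hdist => ?_⟩
  have hφc : Continuous fun z => Metric.infDist (g z) K :=
    (Metric.continuous_infDist_pt K).comp hdiff.continuous
  -- Exact penalization: comparison with `z₀` gives the distance estimate with `κ = 2 / c`. An
  -- infeasible minimizer would have a unit normal whose adjoint image has norm at most `c / 2`, yet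
  -- at least `c - c / 4`.
  obtain ⟨z, hz⟩ := Continuous.exists_forall_le
    (f := fun z => Metric.infDist (g z) K + c / 2 * ‖z - z₀‖) (by fun_prop) (by
      refine tendsto_atTop_mono (fun z => le_add_of_nonneg_left Metric.infDist_nonneg) ?_
      simp_rw [← dist_eq_norm]
      exact (tendsto_dist_right_cocompact_atTop z₀).const_mul_atTop (by positivity))
  have hz₁ := hz z₀
  simp only [sub_self, norm_zero, mul_zero, add_zero] at hz₁
  have hφ0 : 0 ≤ Metric.infDist (g z) K := Metric.infDist_nonneg
  have hzz₀ : ‖z - z₀‖ ≤ κ * Metric.infDist (g z₀) K := by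
    rw [hκ, div_mul_eq_mul_div, le_div_iff₀ hc]
    linarith
  refine ⟨z, ?_, hzz₀⟩
  rw [Set.mem_preimage, hK.mem_iff_infDist_zero hne]
  by_contra hne0
  have hpos : 0 < Metric.infDist (g z) K := lt_of_le_of_ne hφ0 (Ne.symm hne0)
  have hφle : Metric.infDist (g z) K ≤ ρ * t := by
    linarith [mul_nonneg (half_pos hc).le (norm_nonneg (z - z₀))]
  have hzd : ‖z - (x + t • d)‖ ≤ (κ + 1) * ρ * t := by
    calc ‖z - (x + t • d)‖ ≤ ‖z - z₀‖ + ‖z₀ - (x + t • d)‖ := norm_sub_le_norm_sub_add_norm_sub ..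
      _ ≤ κ * (ρ * t) + ρ * t := by gcongr; exact hzz₀.trans (by gcongr)
      _ = _ := by ring
  have hzx : ‖z - x‖ ≤ (1 + ‖d‖) * t := by
    calc ‖z - x‖ = ‖(z - (x + t • d)) + t • d‖ := by congr 1; abel
      _ ≤ (κ + 1) * ρ * t + t * ‖d‖ := by
        refine (norm_add_le _ _).trans ?_
        rw [norm_smul, Real.norm_of_nonneg ht0.le]
        gcongr
      _ ≤ (1 + ‖d‖) * t := by nlinarith
  have hzr : ‖z - x‖ < r := hzx.trans_lt (by nlinarith)
  have hzr₁ : ‖z - x‖ < r₁ := hzx.trans_lt (by nlinarith)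
  obtain ⟨w, hwK, hw⟩ := hK.exists_infDist_eq_dist hne (g z)
  rw [dist_eq_norm] at hw
  have hnorm : 0 < ‖g z - w‖ := hw ▸ hpos
  have hne' : g z - w ≠ 0 := norm_pos_iff.1 hnorm
  have hwd : ‖w - (g x + t • A d)‖ ≤ c * t := by
    have e : w - (g x + t • A d) =
        (g z - g x - A (z - x)) + A (z - (x + t • d)) - (g z - w) := by
      simp only [map_sub, map_add, map_smul]
      abel
    have h1 := hlin z hzr₁
    have h2 := A.le_opNorm (z - (x + t • d))
    calc ‖w - (g x + t • A d)‖
        ≤ ‖g z - g x - A (z - x)‖ + ‖A (z - (x + t • d))‖ + ‖g z - w‖ := by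
          rw [e]
          exact (norm_sub_le _ _).trans (by gcongr; exact norm_add_le _ _)
      _ ≤ c / (4 * (‖d‖ + 1)) * ((1 + ‖d‖) * t) + ‖A‖ * ((κ + 1) * ρ * t) + ρ * t := by
          gcongr
          · exact h1.trans (by gcongr)
          · exact h2.trans (by gcongr)
          · exact hw ▸ hφle
      _ = c / 4 * t + ρ * (1 + ‖A‖ * (κ + 1)) * t := by
          field_simp
          ring
      _ ≤ c / 4 * t + c / 2 * t := by gcongr
      _ ≤ c * t := by nlinarith
  set v := ‖g z - w‖⁻¹ • (g z - w) with hv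
  have hv1 : ‖v‖ = 1 := norm_smul_inv_norm (𝕜 := ℝ) hne'
  have hcv := H t ht0 (ht.trans_le hρ3) w hwd v (smul_mem_frechetNormalCone
    (sub_mem_frechetNormalCone_of_infDist_eq hwK hw) (inv_nonneg.2 hnorm.le)) hv1
  have hGv := hAadj z v hv1 hzr
  have hle := norm_adjoint_le_of_penalized_min (hdiff z) (half_pos hc).le hz hwK hw hne'
  linarith

end Regularity

end DirVar

namespace DirVar

/-! ### Second-order tangents under a `C²` map -/

section SecondOrder

variable {E F : Type*} [NormedAddCommGroup E] [InnerProductSpace ℝ E]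
  [NormedAddCommGroup F] [InnerProductSpace ℝ F]

lemma DownToZero.comp_add {t : ℕ → ℝ} (ht : DownToZero t) (N : ℕ) :
    DownToZero fun k => t (k + N) :=
  ⟨fun k => ht.1 (k + N), (tendsto_add_atTop_iff_nat N).2 ht.2⟩

lemma mem_asymptoticTangentCone_of_eventually {S : Set E} {x d w : E} {t r : ℕ → ℝ} {w' : ℕ → E}
    (ht : DownToZero t) (hr : DownToZero r) (hw : Tendsto w' atTop (𝓝 w))
    (htr : Tendsto (fun k => t k / r k) atTop (𝓝 0))
    (h : ∀ᶠ k in atTop, x + t k • d + ((1 / 2 : ℝ) * t k * r k) • w' k ∈ S) :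
    w ∈ asymptoticTangentCone S x d := by
  obtain ⟨N, hN⟩ := eventually_atTop.1 h
  exact ⟨fun k => t (k + N), fun k => r (k + N), fun k => w' (k + N), ht.comp_add N, hr.comp_add N,
    (tendsto_add_atTop_iff_nat N).2 hw,
    (tendsto_add_atTop_iff_nat (f := fun k => t k / r k) N).2 htr,
    fun k => hN _ (Nat.le_add_left N k)⟩

/-- A `C²` map is approximated by its linearization up to a quadratic error. -/
lemma exists_norm_sub_linearization_le_sq {g : E → F} (hg : ContDiff ℝ 2 g) (x : E) :
    ∃ L r : ℝ, 0 ≤ L ∧ 0 < r ∧ ∀ z, ‖z - x‖ < r →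
      ‖g z - g x - fderiv ℝ g x (z - x)‖ ≤ L * ‖z - x‖ ^ 2 := by
  have hg' : ContDiff ℝ 1 (fderiv ℝ g) := hg.fderiv_right (by norm_num)
  obtain ⟨L, U, hU, hL⟩ := hg'.contDiffAt (x := x).exists_lipschitzOnWith
  obtain ⟨r, hr, hrU⟩ := Metric.mem_nhds_iff.1 hU
  refine ⟨L, r, L.2, hr, fun z hz => ?_⟩
  have hball : Metric.closedBall x ‖z - x‖ ⊆ U :=
    (Metric.closedBall_subset_ball hz).trans hrU
  have key := (convex_closedBall x ‖z - x‖).norm_image_sub_le_of_norm_fderiv_le' (𝕜 := ℝ) (f := g)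
    (φ := fderiv ℝ g x) (C := L * ‖z - x‖)
    (fun y _ => (hg.differentiable two_ne_zero) y) (fun y hy => by
      rw [← dist_eq_norm]
      refine (hL.dist_le_mul y (hball hy) x (hball (Metric.mem_closedBall_self
        (norm_nonneg _)))).trans ?_
      gcongr
      simpa using hy)
    (Metric.mem_closedBall_self (norm_nonneg _)) (y := z) (by simp [dist_eq_norm])
  exact key.trans_eq (by ring)

/-- The linearization error is `O(t²)`; divided by `t * r` it is `O(t / r)`, so no second derivative
of `g` survives. -/
lemma tendsto_secondOrder_quotient {g : E → F} (hg : ContDiff ℝ 2 g) {x d w : E} {t r : ℕ → ℝ}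
    {w' : ℕ → E} (ht : DownToZero t) (hr : DownToZero r) (hw : Tendsto w' atTop (𝓝 w))
    (htr : Tendsto (fun k => t k / r k) atTop (𝓝 0)) :
    Tendsto (fun k => ((1 / 2 : ℝ) * t k * r k)⁻¹ •
      (g (x + t k • d + ((1 / 2 : ℝ) * t k * r k) • w' k) - (g x + t k • fderiv ℝ g x d)))
      atTop (𝓝 (fderiv ℝ g x w)) := by
  obtain ⟨L, δ, hL, hδ, H⟩ := exists_norm_sub_linearization_le_sq hg x
  set A := fderiv ℝ g x
  have hpos : ∀ k, 0 < (1 / 2 : ℝ) * t k * r k := fun k => by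
    have := ht.1 k
    have := hr.1 k
    positivity
  have hAw : Tendsto (fun k => A (w' k)) atTop (𝓝 (A w)) := (A.continuous.tendsto w).comp hw
  rw [← tendsto_sub_nhds_zero_iff] at hAw
  rw [← tendsto_sub_nhds_zero_iff]
  have hs : Tendsto (fun k => d + ((1 / 2 : ℝ) * r k) • w' k) atTop (𝓝 d) := by
    simpa using ((hr.2.const_mul (1 / 2 : ℝ)).smul hw).const_add d
  have hrem : Tendsto (fun k => 2 * L * (t k / r k) * ‖d + ((1 / 2 : ℝ) * r k) • w' k‖ ^ 2)
      atTop (𝓝 0) := by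
    simpa using (htr.const_mul (2 * L)).mul (hs.norm.pow 2)
  have hsmall : ∀ᶠ k in atTop, ‖t k • (d + ((1 / 2 : ℝ) * r k) • w' k)‖ < δ := by
    have : Tendsto (fun k => ‖t k • (d + ((1 / 2 : ℝ) * r k) • w' k)‖) atTop (𝓝 0) := by
      simpa using (ht.2.smul hs).norm
    exact this.eventually_lt_const hδ
  have hdiff : Tendsto (fun k => ((1 / 2 : ℝ) * t k * r k)⁻¹ •
      (g (x + t k • d + ((1 / 2 : ℝ) * t k * r k) • w' k) - (g x + t k • A d)) - A (w' k))
      atTop (𝓝 0) := by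
    refine squeeze_zero_norm' ?_ hrem
    filter_upwards [hsmall] with k hk
    have ht0 := ht.1 k
    have hr0 := hr.1 k
    have e : t k • d + ((1 / 2 : ℝ) * t k * r k) • w' k =
        t k • (d + ((1 / 2 : ℝ) * r k) • w' k) := by
      rw [smul_add, smul_smul]
      congr 2
      ring
    have h1 := H (x + t k • d + ((1 / 2 : ℝ) * t k * r k) • w' k)
      (by rwa [add_assoc, add_sub_cancel_left, e])
    rw [add_assoc x, add_sub_cancel_left, map_add, map_smul, map_smul, ← add_assoc x] at h1
    have e2 : ((1 / 2 : ℝ) * t k * r k)⁻¹ •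
        (g (x + t k • d + ((1 / 2 : ℝ) * t k * r k) • w' k) - (g x + t k • A d)) - A (w' k) =
        ((1 / 2 : ℝ) * t k * r k)⁻¹ •
        (g (x + t k • d + ((1 / 2 : ℝ) * t k * r k) • w' k) - g x -
          (t k • A d + ((1 / 2 : ℝ) * t k * r k) • A (w' k))) := by
      rw [← sub_sub _ (t k • A d), smul_sub _ _ (((1 / 2 : ℝ) * t k * r k) • A (w' k)),
        inv_smul_smul₀ (hpos k).ne', sub_sub (g _) (g x)]
    rw [e2, norm_smul, norm_inv, Real.norm_of_nonneg (hpos k).le, inv_mul_le_iff₀ (hpos k)]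
    refine h1.trans_eq ?_
    rw [e, norm_smul, Real.norm_of_nonneg ht0.le]
    field_simp
  simpa using hdiff.add hAw

lemma fderiv_mem_asymptoticTangentCone {g : E → F} (hg : ContDiff ℝ 2 g) {K : Set F} {x d v : E}
    (hv : v ∈ asymptoticTangentCone (g ⁻¹' K) x d) :
    fderiv ℝ g x v ∈ asymptoticTangentCone K (g x) (fderiv ℝ g x d) := by
  obtain ⟨t, r, w, ht, hr, hw, htr, h⟩ := hv
  refine ⟨t, r, _, ht, hr, tendsto_secondOrder_quotient hg (d := d) ht hr hw htr, htr, fun k => ?_⟩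
  have := ht.1 k
  have := hr.1 k
  rw [smul_inv_smul₀ (by positivity), add_sub_cancel]
  exact h k

lemma fderiv_mem_tangentCone {g : E → F} {K : Set F} {x d : E} (hg : DifferentiableAt ℝ g x)
    (hd : d ∈ tangentCone (g ⁻¹' K) x) : fderiv ℝ g x d ∈ tangentCone K (g x) := by
  obtain ⟨t, d', ht, hd', h⟩ := hd
  refine ⟨t, fun k => (t k)⁻¹ • (g (x + t k • d' k) - g x), ht, ?_, fun k => ?_⟩
  · have htd : Tendsto (fun k => t k • d' k) atTop (𝓝 0) := by simpa using ht.2.smul hd'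
    refine (hasFDerivWithinAt_univ.2 hg.hasFDerivAt).lim htd (.of_forall fun _ => Set.mem_univ _) ?_
    simpa only [inv_smul_smul₀ (ht.1 _).ne'] using hd'
  · rw [smul_inv_smul₀ (ht.1 k).ne', add_sub_cancel]
    exact h k

variable [FiniteDimensional ℝ E] [FiniteDimensional ℝ F]

/-- Under the directional criterion for metric subregularity, a direction whose image is the sum of
a second-order tangent to `K` and a vector polar to the limiting normals of `K` is a second-order
tangent to `g ⁻¹' K`. -/
lemma mem_asymptoticTangentCone_preimage {g : E → F} (hg : ContDiff ℝ 2 g) {K : Set F}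
    (hK : IsClosed K) {x d v : E}
    (hCQ : ∀ lam ∈ dirLimitingNormalCone K (g x) (fderiv ℝ g x d),
      ContinuousLinearMap.adjoint (fderiv ℝ g x) lam = 0 → lam = 0)
    {u p : F} (hu : u ∈ asymptoticTangentCone K (g x) (fderiv ℝ g x d))
    (hp : ∀ lam ∈ dirLimitingNormalCone K (g x) (fderiv ℝ g x d), inner ℝ lam p ≤ 0)
    (hv : fderiv ℝ g x v = u + p) :
    v ∈ asymptoticTangentCone (g ⁻¹' K) x d := by
  obtain ⟨t, r, u', ht, hr, hu', htr, hmem⟩ := hu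
  set A := fderiv ℝ g x
  set ε : ℕ → ℝ := fun k => (1 / 2 : ℝ) * t k * r k with hε
  have hpos : ∀ k, 0 < ε k := fun k => by
    have := ht.1 k
    have := hr.1 k
    positivity
  have hq := tendsto_secondOrder_quotient hg (x := x) (d := d) ht hr
    (tendsto_const_nhds (x := v)) htr
  have hsmall : ∀ (a : ℕ → F) (b : F), Tendsto a atTop (𝓝 b) → ∀ ρ : ℝ, 0 < ρ →
      ∀ᶠ k in atTop, ε k * ‖a k‖ ≤ ρ * t k := by
    intro a b ha ρ hρ
    have : Tendsto (fun k => 1 / 2 * r k * ‖a k‖) atTop (𝓝 0) := by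
      simpa using (hr.2.const_mul (1 / 2 : ℝ)).mul ha.norm
    filter_upwards [this.eventually_lt_const hρ] with k hk
    calc ε k * ‖a k‖ = (1 / 2 * r k * ‖a k‖) * t k := by simp only [hε]; ring
      _ ≤ ρ * t k := by gcongr; exact (ht.1 k).le
  have hεt : ∀ M ρ : ℝ, 0 < ρ → ∀ᶠ k in atTop, ε k * M ≤ ρ * t k := by
    intro M ρ hρ
    have : Tendsto (fun k => 1 / 2 * r k * M) atTop (𝓝 0) := by
      simpa using (hr.2.const_mul (1 / 2 : ℝ)).mul_const M
    filter_upwards [this.eventually_lt_const hρ] with k hk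
    calc ε k * M = (1 / 2 * r k * M) * t k := by simp only [hε]; ring
      _ ≤ ρ * t k := by gcongr; exact (ht.1 k).le
  -- The image point differs from `g x + t • A d + ε • (u' + p)` by `o(ε)`, and polarity of `p`
  -- bounds the distance of the latter to `K` by `η / 2 * ε`.
  have hdist : ∀ η : ℝ, 0 < η → ∀ᶠ k in atTop,
      Metric.infDist (g (x + t k • d + ε k • v)) K ≤ η * ε k := by
    intro η hη
    obtain ⟨ρ, hρ, H⟩ := infDist_add_smul_le_of_polar hK hp (half_pos hη)
    have hdq := ((hq.sub hu').sub_const p).norm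
    rw [hv, add_sub_cancel_left, sub_self, norm_zero] at hdq
    filter_upwards [ht.2.eventually_lt_const hρ, hsmall u' u hu' ρ hρ, hεt 1 ρ hρ,
      hdq.eventually_lt_const (half_pos hη)] with k h1 h2 h3 h4
    have h5 := H (t k) (ht.1 k) h1 _ (hmem k) (by
      rw [add_sub_cancel_left, norm_smul, Real.norm_of_nonneg (hpos k).le]
      exact h2) (ε k) (hpos k).le (by linarith)
    refine (Metric.infDist_le_infDist_add_dist (y := g x + t k • A d + ε k • u' k + ε k • p)).trans
      ?_
    have e : g (x + t k • d + ε k • v) - (g x + t k • A d + ε k • u' k + ε k • p) =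
        ε k • ((ε k)⁻¹ • (g (x + t k • d + ε k • v) - (g x + t k • A d)) - u' k - p) := by
      rw [smul_sub, smul_sub, smul_inv_smul₀ (hpos k).ne']
      abel
    rw [dist_eq_norm, e, norm_smul, Real.norm_of_nonneg (hpos k).le]
    have h6 := mul_le_mul_of_nonneg_left h4.le (hpos k).le
    linarith
  -- Subregularity yields feasible points at distance `o(ε)`, which leaves the limit `v` unchanged.
  obtain ⟨κ, ρ, hκ, hρ, H⟩ := exists_dist_le_infDist_of_directional_criterion
    (hg.of_le (by norm_num)) hK ⟨_, hmem 0⟩ hCQ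
  have hex : ∀ᶠ k in atTop, ∃ z' ∈ g ⁻¹' K, ‖z' - (x + t k • d + ε k • v)‖ ≤
      κ * Metric.infDist (g (x + t k • d + ε k • v)) K := by
    filter_upwards [ht.2.eventually_lt_const hρ, hεt ‖v‖ ρ hρ, hεt 1 ρ hρ, hdist 1 one_pos]
      with k h1 h2 h3 h4
    refine H (t k) (ht.1 k) h1 _ ?_ (by linarith)
    rwa [add_sub_cancel_left, norm_smul, Real.norm_of_nonneg (hpos k).le]
  obtain ⟨z, hz⟩ := hex.choice
  refine mem_asymptoticTangentCone_of_eventually (w' := fun k => (ε k)⁻¹ • (z k - (x + t k • d)))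
    ht hr ?_ htr ?_
  · rw [tendsto_iff_norm_sub_tendsto_zero, Metric.tendsto_nhds]
    intro η hη
    filter_upwards [hz, hdist (η / (2 * κ)) (by positivity)] with k h1 h2
    have e : (ε k)⁻¹ • (z k - (x + t k • d)) - v =
        (ε k)⁻¹ • (z k - (x + t k • d + ε k • v)) := by
      rw [← sub_sub (z k) (x + t k • d), smul_sub _ (z k - (x + t k • d)),
        inv_smul_smul₀ (hpos k).ne']
    rw [dist_zero_right, norm_norm, e, norm_smul, norm_inv, Real.norm_of_nonneg (hpos k).le,
      inv_mul_lt_iff₀ (hpos k)]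
    calc _ ≤ κ * (η / (2 * κ) * ε k) := h1.2.trans (by gcongr)
      _ = ε k * η / 2 := by field_simp
      _ < ε k * η := half_lt_self (mul_pos (hpos k) hη)
  · filter_upwards [hz] with k hk
    rw [smul_inv_smul₀ (hpos k).ne', add_sub_cancel]
    exact hk.1

end SecondOrder

/-! ### Separation and conic duality -/

section Duality

/-- A nonempty convex set in a finite-dimensional space that misses the origin lies in a closed
half-space through the origin. -/
lemma exists_unit_functional_nonneg {V : Type*} [NormedAddCommGroup V] [NormedSpace ℝ V]
    [FiniteDimensional ℝ V] {M : Set V} (hM : Convex ℝ M) (hne : M.Nonempty) (h0 : (0 : V) ∉ M) :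
    ∃ l : V →L[ℝ] ℝ, ‖l‖ = 1 ∧ ∀ y ∈ M, 0 ≤ l y := by
  obtain ⟨y₀, hy₀⟩ := hne
  have : ProperSpace (V →L[ℝ] ℝ) := FiniteDimensional.proper ℝ (V →L[ℝ] ℝ)
  -- `M` need not be closed, so finite subsets are separated strictly through their compact hulls,
  -- and compactness of the dual sphere combines the functionals. Inserting `y₀` makes each
  -- functional nonzero.
  have key : (Metric.sphere (0 : V →L[ℝ] ℝ) 1 ∩ ⋂ y : M, {l | 0 ≤ l y}).Nonempty := by
    refine (isCompact_sphere _ _).inter_iInter_nonempty _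
      (fun y => isClosed_le continuous_const (by fun_prop)) fun I => ?_
    have hfin : (insert y₀ ((↑) '' (I : Set M)) : Set V).Finite :=
      (I.finite_toSet.image _).insert _
    have hsub : convexHull ℝ (insert y₀ ((↑) '' (I : Set M)) : Set V) ⊆ M := by
      refine convexHull_min (Set.insert_subset hy₀ ?_) hM
      rintro _ ⟨y, -, rfl⟩
      exact y.2
    obtain ⟨l, u, hl0, hl⟩ := geometric_hahn_banach_point_closed (x := (0 : V))
      (convex_convexHull ℝ _) (hfin.isCompact_convexHull ℝ).isClosed fun h => h0 (hsub h)
    rw [map_zero] at hl0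
    have hlpos : ∀ y ∈ (insert y₀ ((↑) '' (I : Set M)) : Set V), 0 < l y :=
      fun y hy => hl0.trans (hl y (subset_convexHull ℝ _ hy))
    have hlne : l ≠ 0 := by
      rintro rfl
      exact (hlpos y₀ (Set.mem_insert _ _)).ne' rfl
    refine ⟨‖l‖⁻¹ • l, by simpa using norm_smul_inv_norm (𝕜 := ℝ) hlne, ?_⟩
    simp only [Set.mem_iInter]
    intro y hy
    exact mul_nonneg (inv_nonneg.2 (norm_nonneg l))
      (hlpos y (Set.mem_insert_of_mem _ ⟨y, hy, rfl⟩)).le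
  obtain ⟨l, hl, hl'⟩ := key
  exact ⟨l, by simpa using hl, fun y hy => Set.mem_iInter.1 hl' ⟨y, hy⟩⟩

/-- Let `s → ∞`; this extracts sign conditions from freely scalable variables. -/
lemma nonneg_of_forall_nonneg_add_mul {a b : ℝ} (h : ∀ s : ℝ, 0 < s → 0 ≤ a + s * b) : 0 ≤ b := by
  by_contra! hb
  have h1 := h ((|a| + 1) / -b) (div_pos (by positivity) (neg_pos.2 hb))
  have h2 : (|a| + 1) / -b * b = -(|a| + 1) := by
    have := hb.ne
    field_simp
  linarith [le_abs_self a]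

variable {E F : Type*} [NormedAddCommGroup E] [InnerProductSpace ℝ E] [FiniteDimensional ℝ E]
  [NormedAddCommGroup F] [InnerProductSpace ℝ F] [FiniteDimensional ℝ F]

/-- The bipolar theorem for the closed convex hull of a cone. -/
lemma mem_closure_convexHull_of_bipolar {N : Set F} (h0 : (0 : F) ∈ N)
    (hN : ∀ v ∈ N, ∀ c : ℝ, 0 ≤ c → c • v ∈ N) {b : F}
    (hb : ∀ p, (∀ v ∈ N, inner ℝ v p ≤ 0) → inner ℝ b p ≤ 0) :
    b ∈ closure (convexHull ℝ N) := by
  by_contra hmem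
  obtain ⟨l, u, hl, hlb⟩ := geometric_hahn_banach_closed_point
    (convex_convexHull ℝ N).closure isClosed_closure hmem
  have hsub : N ⊆ closure (convexHull ℝ N) := (subset_convexHull ℝ N).trans subset_closure
  set p := (InnerProductSpace.toDual ℝ F).symm l
  have hpl : ∀ v, inner ℝ v p = l v := fun v => by
    rw [real_inner_comm]
    exact InnerProductSpace.toDual_symm_apply
  have hu : 0 < u := by simpa using hl 0 (hsub h0)
  -- `l` is bounded above by `u` on the cone `N`, hence nonpositive there, while `l b > u > 0`.
  have hbp := hb p fun v hv => by
    rw [hpl]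
    refine neg_nonneg.1 (nonneg_of_forall_nonneg_add_mul (a := u) fun s hs => ?_)
    have := hl _ (hsub (hN v hv s hs.le))
    rw [map_smul, smul_eq_mul] at this
    linarith
  rw [hpl] at hbp
  linarith

/-- Linear conic duality: existence of a multiplier in the closed convex hull of a cone `N`, under
a Robinson-type qualification. -/
lemma exists_multiplier_of_forall_nonneg {A : E →L[ℝ] F} {l : E →L[ℝ] ℝ} {N : Set F}
    (h0 : (0 : F) ∈ N) (hN : ∀ v ∈ N, ∀ c : ℝ, 0 ≤ c → c • v ∈ N)
    (hCQ : ∀ lam, ContinuousLinearMap.adjoint A lam = 0 → lam ∈ closure (convexHull ℝ N) → lam = 0)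
    {U : Set F} (hU : Convex ℝ U) (hUne : U.Nonempty)
    (h : ∀ v, ∀ u ∈ U, ∀ p, (∀ w ∈ N, inner ℝ w p ≤ 0) → A v = u + p → 0 ≤ l v) :
    ∃ lam ∈ closure (convexHull ℝ N), (∀ v, l v + inner ℝ lam (A v) = 0) ∧
      ∀ u ∈ U, inner ℝ lam u ≤ 0 := by
  -- The strict inequality makes `0 ∉ M` exactly the hypothesis `h`.
  set M : Set (ℝ × F) := {q | ∃ v, ∃ u ∈ U, ∃ p, (∀ w ∈ N, inner ℝ w p ≤ 0) ∧ l v < q.1 ∧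
    q.2 = u + p - A v}
  have hM : Convex ℝ M := by
    rintro ⟨s₁, y₁⟩ ⟨v₁, u₁, hu₁, p₁, hp₁, hs₁, hy₁⟩ ⟨s₂, y₂⟩ ⟨v₂, u₂, hu₂, p₂, hp₂, hs₂, hy₂⟩
      a b ha hb hab
    refine ⟨a • v₁ + b • v₂, a • u₁ + b • u₂, hU hu₁ hu₂ ha hb hab, a • p₁ + b • p₂,
      fun w hw => ?_, ?_, ?_⟩
    · rw [inner_add_right, real_inner_smul_right, real_inner_smul_right]
      exact add_nonpos (mul_nonpos_of_nonneg_of_nonpos ha (hp₁ w hw))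
        (mul_nonpos_of_nonneg_of_nonpos hb (hp₂ w hw))
    · simp only [map_add, map_smul, smul_eq_mul, Prod.fst_add, Prod.smul_fst]
      dsimp only at hs₁ hs₂
      rcases ha.eq_or_lt with rfl | ha
      · obtain rfl : b = 1 := by linarith
        simpa using hs₂
      · exact add_lt_add_of_lt_of_le (by gcongr) (by gcongr)
    · dsimp only at hy₁ hy₂
      simp only [map_add, map_smul, Prod.snd_add, Prod.smul_snd, hy₁, hy₂, smul_add, smul_sub]
      abel
  obtain ⟨u₀, hu₀⟩ := hUne
  have hzero : ((0 : ℝ × F)) ∉ M := by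
    rintro ⟨v, u, hu, p, hp, hs, hy⟩
    exact hs.not_ge (h v u hu p hp (sub_eq_zero.1 hy.symm).symm)
  obtain ⟨φ, hφ1, hφ⟩ := exists_unit_functional_nonneg hM
    ⟨(1, u₀), 0, u₀, hu₀, 0, by simp, by simp, by simp⟩ hzero
  set α := φ (1, 0) with hα
  set b := (InnerProductSpace.toDual ℝ F).symm (φ.comp (ContinuousLinearMap.inr ℝ ℝ F)) with hb
  have hφe : ∀ s y, φ (s, y) = α * s + inner ℝ b y := by
    intro s y
    have e : ((s, y) : ℝ × F) = s • ((1, 0) : ℝ × F) + (0, y) := by simp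
    rw [e, map_add, map_smul, smul_eq_mul, hb, InnerProductSpace.toDual_symm_apply, mul_comm]
    simp [hα]
  have key : ∀ v, ∀ u ∈ U, ∀ p, (∀ w ∈ N, inner ℝ w p ≤ 0) → ∀ s, l v < s →
      0 ≤ α * s + (inner ℝ b u + inner ℝ b p - inner ℝ b (A v)) := by
    intro v u hu p hp s hs
    have := hφ (s, u + p - A v) ⟨v, u, hu, p, hp, hs, rfl⟩
    rwa [hφe, inner_sub_right, inner_add_right] at this
  have hα0 : 0 ≤ α := nonneg_of_forall_nonneg_add_mul (a := inner ℝ b u₀) fun s hs => by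
    have := key 0 u₀ hu₀ 0 (by simp) s (by simpa using hs)
    simp only [inner_zero_right, map_zero] at this
    linarith
  have hbp : ∀ p, (∀ w ∈ N, inner ℝ w p ≤ 0) → 0 ≤ inner ℝ b p := fun p hp =>
    nonneg_of_forall_nonneg_add_mul (a := α + inner ℝ b u₀) fun s hs => by
      have := key 0 u₀ hu₀ (s • p) (fun w hw => by
        rw [real_inner_smul_right]
        exact mul_nonpos_of_nonneg_of_nonpos hs.le (hp w hw)) 1 (by simp)
      rw [real_inner_smul_right, map_zero, inner_zero_right] at this
      linarith
  have hle : ∀ v, 0 ≤ α * l v - inner ℝ b (A v) := fun v =>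
    nonneg_of_forall_nonneg_add_mul (a := α + inner ℝ b u₀) fun s hs => by
      have := key (s • v) u₀ hu₀ 0 (by simp) (s * l v + 1) (by simp)
      rw [map_smul, real_inner_smul_right, inner_zero_right] at this
      linarith
  have heq : ∀ v, α * l v = inner ℝ b (A v) := fun v => by
    have h1 := hle v
    have h2 := hle (-v)
    simp only [map_neg, inner_neg_right] at h2
    linarith
  have hbu : ∀ u ∈ U, 0 ≤ inner ℝ b u := fun u hu => by
    refine le_of_forall_pos_le_add fun s hs => ?_
    have := key 0 u hu 0 (by simp) (s / (α + 1)) (by rw [map_zero]; positivity)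
    simp only [inner_zero_right, map_zero] at this
    have h2 : α * (s / (α + 1)) ≤ s := by
      rw [mul_div_assoc', div_le_iff₀ (by positivity)]
      nlinarith
    linarith
  have hmem : ∀ c : ℝ, 0 ≤ c → -(c • b) ∈ closure (convexHull ℝ N) := fun c hc =>
    mem_closure_convexHull_of_bipolar h0 hN fun p hp => by
      rw [inner_neg_left, real_inner_smul_left]
      exact neg_nonpos.2 (mul_nonneg hc (hbp p hp))
  rcases hα0.eq_or_lt' with hα' | hα'
  -- Abnormal case: `-b` lies in the kernel of the adjoint and in the closed convex hull of `N`, so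
  -- `b = 0` and `φ = 0`, against `‖φ‖ = 1`.
  · have hb0 : -((1 : ℝ) • b) = 0 := by
      refine hCQ _ (ext_inner_right ℝ fun v => ?_) (hmem 1 zero_le_one)
      rw [ContinuousLinearMap.adjoint_inner_left, one_smul, inner_neg_left, ← heq, hα']
      simp
    rw [one_smul, neg_eq_zero] at hb0
    have : φ = 0 := by
      ext q <;> simp [hφe, hα', hb0]
    simp [this] at hφ1
  · refine ⟨-(α⁻¹ • b), hmem _ (inv_nonneg.2 hα0), fun v => ?_, fun u hu => ?_⟩
    · rw [inner_neg_left, real_inner_smul_left, ← heq, inv_mul_cancel_left₀ hα'.ne', add_neg_cancel]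
    · rw [inner_neg_left, real_inner_smul_left]
      exact neg_nonpos.2 (mul_nonneg (inv_nonneg.2 hα0) (hbu u hu))

end Duality

/-! ### Lagrangian stationarity and the equivalence -/

section Multipliers

variable {n m : ℕ}

lemma gradient_lagrangian_eq_zero_iff {f : EuclideanSpace ℝ (Fin n) → ℝ}
    {g : EuclideanSpace ℝ (Fin n) → EuclideanSpace ℝ (Fin m)} {x : EuclideanSpace ℝ (Fin n)}
    (hf : DifferentiableAt ℝ f x) (hg : DifferentiableAt ℝ g x) (lam : EuclideanSpace ℝ (Fin m)) :
    gradient (fun y => lagrangian f g y lam) x = 0 ↔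
      ∀ v, fderiv ℝ f x v + inner ℝ lam (fderiv ℝ g x v) = 0 := by
  have hL : HasFDerivAt (fun y => lagrangian f g y lam)
      (fderiv ℝ f x + (innerSL ℝ lam).comp (fderiv ℝ g x)) x :=
    hf.hasFDerivAt.add ((innerSL ℝ lam).hasFDerivAt.comp x hg.hasFDerivAt)
  rw [gradient, hL.fderiv, map_eq_zero_iff _ (LinearIsometryEquiv.injective _),
    ContinuousLinearMap.ext_iff]
  rfl

end Multipliers

end DirVar

theorem proposition4p9 {n m : ℕ}
    (f : EuclideanSpace ℝ (Fin n) → ℝ)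
    (g : EuclideanSpace ℝ (Fin n) → EuclideanSpace ℝ (Fin m))
    (K : Set (EuclideanSpace ℝ (Fin m)))
    (hf : ContDiff ℝ 2 f) (hg : ContDiff ℝ 2 g) (hK : IsClosed K)
    (x d : EuclideanSpace ℝ (Fin n))
    (hd : d ∈ DirVar.tangentCone (g ⁻¹' K) x)
    (hx : DirVar.IsDirLocalMin f (g ⁻¹' K) x d)
    (hfd : fderiv ℝ f x d = 0)
    (hCQ : DirVar.DirRobinsonCQ g K x d) :
    List.TFAE [
      ∀ v ∈ DirVar.asymptoticTangentCone (g ⁻¹' K) x d, 0 ≤ fderiv ℝ f x v,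
      ∀ u ∈ DirVar.asymptoticTangentCone K (g x) (fderiv ℝ g x d),
        ∃ lam ∈ DirVar.dirClarkeMultipliers f g K x d, inner ℝ lam u ≤ 0,
      ∀ Kd : Set (EuclideanSpace ℝ (Fin m)), Kd.Nonempty → Convex ℝ Kd →
        Kd ⊆ DirVar.asymptoticTangentCone K (g x) (fderiv ℝ g x d) →
        ∃ lam ∈ DirVar.dirClarkeMultipliers f g K x d, DirVar.supportFun Kd lam ≤ 0] := by
  have hf' : DifferentiableAt ℝ f x := hf.differentiable two_ne_zero x
  have hg' : DifferentiableAt ℝ g x := hg.differentiable two_ne_zero x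
  tfae_have 1 → 3 := by
    intro h Kd hne hconv hsub
    obtain ⟨lam, hlam, hstat, hle⟩ := DirVar.exists_multiplier_of_forall_nonneg
      (DirVar.zero_mem_dirLimitingNormalCone
        (DirVar.fderiv_mem_tangentCone hg' hd))
      (fun v hv c hc => DirVar.smul_mem_dirLimitingNormalCone hv hc) hCQ hconv hne
      (l := fderiv ℝ f x) fun v u hu p hp hv =>
        h v (DirVar.mem_asymptoticTangentCone_preimage hg hK
          -- Subregularity needs the qualification only on limiting normals; duality uses it on the
          -- whole Clarke cone.
          (fun lam hlam h0 => hCQ lam h0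
            (DirVar.dirLimitingNormalCone_subset_dirClarkeNormalCone hlam)) (hsub hu) hp hv)
    exact ⟨lam, ⟨hlam, (DirVar.gradient_lagrangian_eq_zero_iff hf' hg' lam).2 hstat⟩,
      iSup₂_le fun u hu => EReal.coe_nonpos.2 (hle u hu)⟩
  tfae_have 3 → 2 := by
    intro h u hu
    obtain ⟨lam, hlam, hle⟩ := h {u} (Set.singleton_nonempty u) (convex_singleton u)
      (Set.singleton_subset_iff.2 hu)
    exact ⟨lam, hlam, by simpa [DirVar.supportFun] using hle⟩
  tfae_have 2 → 1 := by
    intro h v hv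
    obtain ⟨lam, hlam, hle⟩ := h _ (DirVar.fderiv_mem_asymptoticTangentCone hg hv)
    have := (DirVar.gradient_lagrangian_eq_zero_iff hf' hg' lam).1 hlam.2 v
    linarith
  tfae_finish
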